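/- A real-time Büchi automaton with one counter has a finite state set $K$, a finite alphabet $\Sigma$, an initial state, a set of accepting states, and a transition relation $\Delta\subseteq K\times\Sigma\times\{0,1\}\times K\times\{-1,0,1\}$. A transition $(q,a,i,q',j)\in\Delta$ leads, on reading the letter $a$, from the configuration $(q,c)$ to $(q',c+j)$, where $c\in\mathbb N$ and $i=0$ if $c=0$, $i=1$ if $c>0$; transitions with $i=0$, $j=-1$ are not allowed. The counter is blind if $(q,a,0,q',j)\in\Delta$ implies $(q,a,1,q',j)\in\Delta$. An $\omega$-word is accepted if it has a run that starts in the initial state with counter value $0$ and visits some accepting state infinitely often. Let $\Sigma_0=\{{<},d,{|},i,{+},{-},{>}\}$ and $\Sigma=\Sigma_0\cup\{\sharp\}$. Let $\mathcal A_1$ be the automaton over $\Sigma$ with states $q_0,q_1,q_2,q_a,q_r,q_3$, initial state $q_0$, unique accepting state $q_a$, and the following edges, where $q\xrightarrow{a:j}q'$ adds $j$ to the counter (a decrement being enabled only when the counter is positive, and every other edge for every counter value) and $j=0$ when it is not written: $$q_0\xrightarrow{a}q_0\ \text{ and }\ q_3\xrightarrow{a}q_3\ \text{ for all } a\in\Sigma_0,\qquad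 q_0\xrightarrow{<}q_1,\quad q_1\xrightarrow{d:-1}q_1,\quad q_1\xrightarrow{|}q_2,\quad q_2\xrightarrow{i:+1}q_2,$$ $$q_2\xrightarrow{+}q_a,\quad q_2\xrightarrow{-}q_r,\quad q_a\xrightarrow{>}q_3,\quad q_r\xrightarrow{>}q_3,\quad q_3\xrightarrow{\sharp}q_0.$$ **Theorem.** The counter of $\mathcal A_1$ is blind, and the $\omega$-language $L(\mathcal A_1)\subseteq\Sigma^\omega$ is $\boldsymbol\Sigma^1_1$-complete, that is, for every finite alphabet $Y$, a set $E\subseteq Y^\omega$ is analytic if and only if $E=f^{-1}(L(\mathcal A_1))$ for some continuous $f:Y^\omega\to\Sigma^\omega$ (with respect to the product topologies of discrete alphabets). Moreover, $L(\mathcal A_1)$ is not Borel. -/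

import Mathlib

namespace BlindCounter

/-- A non-deterministic real-time Büchi `k`-counter automaton `⟨K, S, Δ, q₀, F⟩` with finite state
set `K` and finite input alphabet `S`. The transition relation is
`Δ ⊆ K × S × {0,1}^k × K × {0,1,-1}^k`: in `Δ q a i q' j`, the vector `i` holds the outcomes of the
zero tests (`i m = false` stands for `0`, "the `m`-th counter is zero", and `i m = true` for `1`,
"the `m`-th counter is positive"), and `j` holds the increments of the counters.
A counter that is zero is never decremented. -/
structure BuchiCounterAutomaton (k : ℕ) (K S : Type) [Finite K] [Finite S] where
  Δ : K → S → (Fin k → Bool) → K → (Fin k → SignType) → Prop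
  q₀ : K
  F : Set K
  no_decrement_of_zero : ∀ q a i q' j, Δ q a i q' j → ∀ m, i m = false → j m ≠ -1

namespace BuchiCounterAutomaton

variable {k : ℕ} {K S : Type} [Finite K] [Finite S]

/-- All counters are blind: a transition enabled when the `m`-th counter is zero is also
enabled, everything else unchanged, when that counter is positive. -/
def IsBlind (M : BuchiCounterAutomaton k K S) : Prop :=
  ∀ q a i q' j m, M.Δ q a i q' j → i m = false → M.Δ q a (Function.update i m true) q' j

/-- `M.Step a x y` is the relation `a : x ↦ y` between configurations `(q, c₁, …, c_k)`. -/
def Step (M : BuchiCounterAutomaton k K S) (a : S) (x y : K × (Fin k → ℕ)) : Prop :=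
  ∃ (i : Fin k → Bool) (j : Fin k → SignType), M.Δ x.1 a i y.1 j ∧
    (∀ m, i m = false ↔ x.2 m = 0) ∧ ∀ m, (y.2 m : ℤ) = (x.2 m : ℤ) + (j m : ℤ)

/-- `r` is a run of `M` on the `ω`-word `σ` (positions are numbered from `0`). -/
def IsRun (M : BuchiCounterAutomaton k K S) (σ : ℕ → S) (r : ℕ → K × (Fin k → ℕ)) : Prop :=
  r 0 = (M.q₀, fun _ => 0) ∧ ∀ n, M.Step (σ n) (r n) (r (n + 1))

/-- The set `In(r)` of the states that are visited infinitely often by `r`. -/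
def infStates (r : ℕ → K × (Fin k → ℕ)) : Set K :=
  {q | {n | (r n).1 = q}.Infinite}

/-- The `ω`-language accepted by `M` (Büchi acceptance). -/
def language (M : BuchiCounterAutomaton k K S) : Set (ℕ → S) :=
  {σ | ∃ r, M.IsRun σ r ∧ (infStates r ∩ M.F).Nonempty}

end BuchiCounterAutomaton

/-- `F ⊆ S^ω` is `Σ¹₁`-complete (boldface): for every finite alphabet `Y`, a set `E ⊆ Y^ω` is
analytic if and only if it is the preimage of `F` under a continuous function `Y^ω → S^ω`.
Alphabets are discrete, and `S^ω`, `Y^ω` have the product topology. -/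
def IsSigma11Complete {S : Type} [Finite S] [TopologicalSpace S] [DiscreteTopology S]
    (F : Set (ℕ → S)) : Prop :=
  ∀ (Y : Type) [Finite Y] [TopologicalSpace Y] [DiscreteTopology Y] (E : Set (ℕ → Y)),
    MeasureTheory.AnalyticSet E ↔ ∃ f : (ℕ → Y) → (ℕ → S), Continuous f ∧ E = f ⁻¹' F

/-- The alphabet `{<, d, |, i, +, -, >, ♯}`, in this order. -/
inductive Letter where
  | lt | d | bar | i | plus | minus | gt | sharp
  deriving DecidableEq

instance : Fintype Letter where
  elems := {.lt, .d, .bar, .i, .plus, .minus, .gt, .sharp}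
  complete := by intro a; cases a <;> decide

instance : TopologicalSpace Letter := ⊥

instance : DiscreteTopology Letter := ⟨rfl⟩

/-- The states `q₀, q₁, q₂, q_a, q_r, q₃`. -/
inductive Ctrl where
  | q0 | q1 | q2 | qa | qr | q3
  deriving DecidableEq

instance : Fintype Ctrl where
  elems := {.q0, .q1, .q2, .qa, .qr, .q3}
  complete := by intro q; cases q <;> decide

/-- `Edge q a j q'`: there is an edge from `q` to `q'` with letter `a` and counter increment `j`. -/
inductive Edge : Ctrl → Letter → SignType → Ctrl → Prop
  | skip0 (a : Letter) (ha : a ≠ .sharp) : Edge .q0 a 0 .q0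
  | choose : Edge .q0 .lt 0 .q1
  | dec : Edge .q1 .d (-1) .q1
  | bar : Edge .q1 .bar 0 .q2
  | inc : Edge .q2 .i 1 .q2
  | accept : Edge .q2 .plus 0 .qa
  | reject : Edge .q2 .minus 0 .qr
  | closeAccept : Edge .qa .gt 0 .q3
  | closeReject : Edge .qr .gt 0 .q3
  | skip3 (a : Letter) (ha : a ≠ .sharp) : Edge .q3 a 0 .q3
  | next : Edge .q3 .sharp 0 .q0

/-- The `1`-counter Büchi automaton whose transitions are the edges above, each enabled for both
outcomes of the zero test, except that a decrement is enabled only if the counter is positive. -/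
def A₁ : BuchiCounterAutomaton 1 Ctrl Letter where
  Δ q a i q' j := Edge q a (j 0) q' ∧ (i 0 = false → j 0 ≠ -1)
  q₀ := .q0
  F := {.qa}
  no_decrement_of_zero := by
    intro q a i q' j h m hm
    rw [Subsingleton.elim m 0] at hm ⊢
    exact h.2 hm

end BlindCounter

/-!
The language is analytic because a run is an infinite word over a countable alphabet, and being an
accepting run is a Borel condition. It remains to reduce every analytic set `E` of infinite words
to the language. The difficulty is that a blind counter can only be tested from below.

Every analytic set has a normal form (`exists_tree_of_analyticSet`): `x ∈ E` iff a binary tree,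
whose level `k` is determined by the first `k` letters of `x`, has an infinite branch containing
infinitely many zeros. The lengths of the blocks of ones map the set of such branches continuously
onto the Baire space, so this is the usual tree representation of analytic sets.

A branch is turned into a descending sequence of dyadic rationals. A node of level `k` is a dyadic
interval `[a / 2 ^ k, (a + 1) / 2 ^ k]`, and the right endpoints of the intervals along a branch
decrease strictly at each digit `0` and stay the same at each digit `1`. Conversely, suppose that a
position never increases and infinitely often drops strictly to the right endpoint of a node of the
tree. Then it stays strictly above its limit. Take the binary expansion of the limit that has infinitely
many zeros: the nodes used late enough extend any given prefix of it, so it is a branch of the tree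
(`exists_isBranch_of_positions`). Only inequalities between positions occur here, and these are
what a blind counter can check.

The position `j / 2 ^ k` at level `k` is represented by the counter value `scale k * j`. A move
subtracts the position it requires and adds the new position, already in the scale of the next
level. Whatever is left over by a player who is higher than required is smaller than the next
scaling factor, and so has no influence on later comparisons
(`exists_isBranch_of_isWinningPlay`). A block of the input word lists the finitely many moves of a
level as `<dⁿ|iᵐ±>`, and the automaton must choose exactly one of them
(`concat_mem_language_iff`).

The language is not Borel since otherwise all analytic sets would be Borel, in contradiction to a
diagonal argument based on the same normal form (`not_analyticSet_compl_selfAccepting`).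
-/

namespace BlindCounter

open Filter Topology MeasureTheory

/-! ### Dyadic branches and analytic sets -/

/-- An infinite binary word containing infinitely many zeros. The word is given by the numbers
`B n < 2 ^ n` that its prefixes of length `n` denote in base two, so that dropping the last
digit is division by `2`, and the prefix of length `n > 0` ends with `0` iff `B n` is even. -/
structure IsBranch (B : ℕ → ℕ) : Prop where
  zero : B 0 = 0
  half : ∀ n, B (n + 1) / 2 = B n
  even : ∃ᶠ n in atTop, Even (B n)

theorem half_iterate {B : ℕ → ℕ} (h : ∀ n, B (n + 1) / 2 = B n) (n m : ℕ) :
    B (n + m) / 2 ^ m = B n := by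
  induction m with
  | zero => simp
  | succ m ih => rw [← add_assoc, pow_succ', ← Nat.div_div_eq_div_mul, h, ih]

theorem IsBranch.div_pow {B : ℕ → ℕ} (h : IsBranch B) {n k : ℕ} (hnk : n ≤ k) :
    B k / 2 ^ (k - n) = B n := by
  obtain ⟨m, rfl⟩ := Nat.exists_eq_add_of_le hnk
  simpa using half_iterate h.half n m

theorem IsBranch.eq_of_le {B C : ℕ → ℕ} (hB : IsBranch B) (hC : IsBranch C) {n k : ℕ}
    (hnk : n ≤ k) (h : B k = C k) : B n = C n := by
  rw [← hB.div_pow hnk, ← hC.div_pow hnk, h]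

theorem IsBranch.lt_two_pow {B : ℕ → ℕ} (hB : IsBranch B) (n : ℕ) : B n < 2 ^ n := by
  induction n with
  | zero => simp [hB.zero]
  | succ n ih => have := hB.half n; rw [pow_succ]; omega

/-- The digit of index `i` is zero. -/
def ZeroAt (B : ℕ → ℕ) (i : ℕ) : Prop := Even (B (i + 1))

theorem IsBranch.infinite_zeroAt {B : ℕ → ℕ} (hB : IsBranch B) :
    (Set.ofPred (ZeroAt B)).Infinite := by
  refine Nat.frequently_atTop_iff_infinite.1 ?_
  refine frequently_atTop.2 fun a => ?_
  obtain ⟨b, hb, h⟩ := frequently_atTop.1 hB.even (a + 1)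
  exact ⟨b - 1, by omega, by rwa [ZeroAt, Nat.sub_add_cancel (by omega)]⟩

theorem nth_congr_of_le {p q : ℕ → Prop} (hp : (Set.ofPred p).Infinite) {n : ℕ}
    (h : ∀ i ≤ Nat.nth p n, (p i ↔ q i)) : Nat.nth q n = Nat.nth p n := by
  classical
  set N := Nat.nth p n with hN
  have hpN : p N := Nat.nth_mem_of_infinite hp n
  have hq : Nat.count q N = n := by
    rw [← Nat.count_nth_of_infinite hp n, ← hN, Nat.count_eq_card_filter_range,
      Nat.count_eq_card_filter_range]
    congr 1
    ext i
    simp only [Finset.mem_filter, Finset.mem_range]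
    exact ⟨fun ⟨a, b⟩ => ⟨a, (h i a.le).2 b⟩, fun ⟨a, b⟩ => ⟨a, (h i a.le).1 b⟩⟩
  rw [← Nat.nth_count ((h N le_rfl).1 hpN), hq]

/-- The sequence of lengths of the blocks of ones between consecutive zeros of a binary word
(the ones before the first zero are ignored). -/
noncomputable def gaps (B : ℕ → ℕ) (n : ℕ) : ℕ :=
  Nat.nth (ZeroAt B) (n + 1) - Nat.nth (ZeroAt B) n - 1

theorem IsBranch.exists_gaps_eq {B : ℕ → ℕ} (hB : IsBranch B) (n : ℕ) :
    ∃ N, ∀ C, IsBranch C → ∀ k ≥ N, C k = B k → gaps C n = gaps B n := by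
  refine ⟨Nat.nth (ZeroAt B) (n + 1) + 1, fun C hC k hk h => ?_⟩
  have key : ∀ i ≤ Nat.nth (ZeroAt B) (n + 1), (ZeroAt B i ↔ ZeroAt C i) := fun i hi => by
    rw [ZeroAt, ZeroAt, hC.eq_of_le hB (by omega) h]
  rw [gaps, gaps, nth_congr_of_le hB.infinite_zeroAt key,
    nth_congr_of_le hB.infinite_zeroAt fun i hi =>
      key i (hi.trans (Nat.nth_monotone hB.infinite_zeroAt (Nat.le_succ n)))]

theorem exists_isBranch_gaps_eq (b : ℕ → ℕ) : ∃ B, IsBranch B ∧ gaps B = b := by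
  classical
  let P : ℕ → ℕ := fun n => ∑ i ∈ Finset.range n, (b i + 1)
  have hPs : ∀ n, P (n + 1) = P n + (b n + 1) := fun n => Finset.sum_range_succ _ _
  have hP : StrictMono P := strictMono_nat_of_lt_succ fun n => by rw [hPs]; omega
  let B : ℕ → ℕ := fun n => Nat.rec 0 (fun n x => 2 * x + if n ∈ Set.range P then 0 else 1) n
  have hBs : ∀ n, B (n + 1) = 2 * B n + if n ∈ Set.range P then 0 else 1 := fun n => rfl
  have hz : ∀ i, ZeroAt B i ↔ i ∈ Set.range P := fun i => by
    rw [ZeroAt, hBs]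
    split_ifs with h <;> simp [h]
  have hB : IsBranch B := by
    refine ⟨rfl, fun n => ?_, frequently_atTop.2 fun a => ?_⟩
    · rw [hBs]; split_ifs <;> omega
    · exact ⟨P a + 1, (hP.le_apply).trans (Nat.le_succ _), (hz _).2 ⟨a, rfl⟩⟩
  refine ⟨B, hB, ?_⟩
  have hnth : Nat.nth (ZeroAt B) = P := by
    refine (StrictMono.range_inj (Nat.nth_strictMono hB.infinite_zeroAt) hP).1 ?_
    rw [Nat.range_nth_of_infinite hB.infinite_zeroAt]
    ext i
    exact hz i
  funext n
  rw [gaps, hnth, hPs]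
  omega

/-- The list of the first `k` letters of an infinite word. -/
def pref {Y : Type*} (x : ℕ → Y) (k : ℕ) : List Y := (List.range k).map x

theorem pref_eq_iff {Y : Type*} {x y : ℕ → Y} {k : ℕ} :
    pref x k = pref y k ↔ ∀ i < k, x i = y i := by
  simp [pref, List.map_inj_left]

theorem isLocallyConstant_pref {Y : Type*} [TopologicalSpace Y] [DiscreteTopology Y] (k : ℕ) :
    IsLocallyConstant fun x : ℕ → Y => pref x k := by
  refine IsLocallyConstant.iff_eventually_eq _ |>.2 fun x => ?_
  have : ∀ᶠ y in 𝓝 x, ∀ i ∈ Finset.range k, y i = x i := by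
    refine (Finset.eventually_all _).2 fun i _ => ?_
    have hi : Tendsto (fun y : ℕ → Y => y i) (𝓝 x) (𝓝 (x i)) := (continuous_apply i).tendsto x
    rwa [nhds_discrete Y, tendsto_pure] at hi
  filter_upwards [this] with y hy
  exact pref_eq_iff.2 fun i hi => hy i (Finset.mem_range.2 hi)

/-- A normal form of analytic sets of infinite words: membership of `x` is the existence of an
infinite branch, with infinitely many zeros, through a binary tree whose level `k` depends on
the first `k` letters of `x` only. -/
theorem exists_tree_of_analyticSet {Y : Type*} [TopologicalSpace Y] [DiscreteTopology Y]
    {E : Set (ℕ → Y)} (hE : AnalyticSet E) :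
    ∃ R : List Y → ℕ → Prop,
      (∀ x k n a, n ≤ k → R (pref x k) a → R (pref x n) (a / 2 ^ (k - n))) ∧
      ∀ x, x ∈ E ↔ ∃ B, IsBranch B ∧ ∀ k, R (pref x k) (B k) := by
  rw [AnalyticSet] at hE
  rcases hE with rfl | ⟨f, hf, rfl⟩
  · exact ⟨fun _ _ => False, by simp, by simp⟩
  -- A node is kept if it lies on a branch whose value under `f` has the prescribed prefix.
  refine ⟨fun u a => ∃ B, IsBranch B ∧ B u.length = a ∧ pref (f (gaps B)) u.length = u, ?_, ?_⟩
  · rintro x k n a hnk ⟨B, hB, h1, h2⟩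
    simp only [pref, List.length_map, List.length_range] at h1 h2 ⊢
    refine ⟨B, hB, by rw [← h1, hB.div_pow hnk], pref_eq_iff.2 fun i hi => ?_⟩
    exact pref_eq_iff.1 h2 i (by omega)
  · intro x
    constructor
    · rintro ⟨b, rfl⟩
      obtain ⟨B, hB, rfl⟩ := exists_isBranch_gaps_eq b
      exact ⟨B, hB, fun k => ⟨B, hB, by simp [pref], by simp [pref]⟩⟩
    · rintro ⟨B, hB, h⟩
      choose C hC h1 h2 using h
      simp only [pref, List.length_map, List.length_range] at h1 h2
      have hlim : Tendsto (fun k => gaps (C k)) atTop (𝓝 (gaps B)) := by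
        refine tendsto_pi_nhds.2 fun n => tendsto_nhds_of_eventually_eq ?_
        obtain ⟨N, hN⟩ := hB.exists_gaps_eq n
        exact eventually_atTop.2 ⟨N, fun k hk => hN (C k) (hC k) k hk (h1 k)⟩
      refine ⟨gaps B, funext fun i => ?_⟩
      have hi := tendsto_pi_nhds.1 ((hf.tendsto _).comp hlim) i
      refine tendsto_nhds_unique hi (tendsto_nhds_of_eventually_eq ?_)
      exact eventually_atTop.2 ⟨i + 1, fun k hk => pref_eq_iff.1 (h2 k) i hk⟩

/-! ### Counter games on dyadic rationals -/

/-- Scaling factors for the counter values at level `k`. They grow so fast that the part of the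
counter left over at level `k` is negligible at level `k + 1`. -/
def scale : ℕ → ℕ
  | 0 => 1
  | k + 1 => scale k * (2 ^ k + 1)

theorem scale_pos (k : ℕ) : 0 < scale k := by
  induction k with
  | zero => simp [scale]
  | succ k ih => simp only [scale]; positivity

/-- A sequence of positions `J k`, read as the dyadic rationals `J k / 2 ^ k`, that never
increases and that infinitely often jumps from strictly above to the right endpoint of an interval
`[a / 2 ^ k, (a + 1) / 2 ^ k]` with `R k a`, determines an infinite branch: the digits of the
limit, expanded so as to have infinitely many zeros. -/
theorem exists_isBranch_of_positions {R : ℕ → ℕ → Prop}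
    (hR : ∀ k n a, n ≤ k → R k a → R n (a / 2 ^ (k - n))) {J : ℕ → ℕ} (hJ1 : J 1 ≤ 2)
    (hJ : ∀ k ≥ 1, J (k + 1) ≤ 2 * J k)
    (hev : ∃ᶠ k in atTop, ∃ a, R k a ∧ a + 2 ≤ J k ∧ J (k + 1) = 2 * (a + 1)) :
    ∃ B, IsBranch B ∧ ∀ k, R k (B k) := by
  have hJpos : ∀ k ≥ 1, 1 ≤ J k := by
    intro k hk
    by_contra h0
    have hz : ∀ m, J (k + m) = 0 := fun m => by
      induction m with
      | zero => rw [add_zero]; omega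
      | succ m ih => have := hJ (k + m) (by omega); rw [ih] at this; exact Nat.le_zero.1 this
    obtain ⟨b, hb, a, -, h, -⟩ := frequently_atTop.1 hev k
    obtain ⟨m, rfl⟩ := Nat.exists_eq_add_of_le hb
    rw [hz] at h
    omega
  -- `D n m` consists of the first `n` digits of the position at level `n + m + 1`,
  -- an endpoint being approached from the left.
  let D : ℕ → ℕ → ℕ := fun n m => (J (n + m + 1) - 1) / 2 ^ (m + 1)
  have hDanti : ∀ n, Antitone (D n) := fun n => antitone_nat_of_succ_le fun m => by
    have h1 := hJ (n + m + 1) (by omega)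
    have h2 := hJpos (n + m + 1) (by omega)
    change (J (n + m + 1 + 1) - 1) / 2 ^ (m + 1 + 1) ≤ (J (n + m + 1) - 1) / 2 ^ (m + 1)
    rw [pow_succ' 2 (m + 1), ← Nat.div_div_eq_div_mul]
    exact Nat.div_le_div_right (by omega)
  have hlim : ∀ n, ∃ v N, ∀ m ≥ N, D n m = v := fun n => by
    obtain ⟨N, hN⟩ := WellFoundedLT.antitone_chain_condition (hDanti n)
    exact ⟨_, N, fun m hm => (hN m hm).symm⟩
  choose B N hB using hlim
  have hBle : ∀ n m, B n ≤ D n m := fun n m => by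
    rw [← hB n (max m (N n)) (le_max_right _ _)]
    exact hDanti n (le_max_left _ _)
  have hhalf : ∀ n, B (n + 1) / 2 = B n := fun n => by
    rw [← hB (n + 1) (max (N n) (N (n + 1))) (le_max_right _ _),
      ← hB n (max (N n) (N (n + 1)) + 1) ((le_max_left _ _).trans (Nat.le_succ _))]
    change (J (n + 1 + _ + 1) - 1) / 2 ^ (_ + 1) / 2 = (J (n + (_ + 1) + 1) - 1) / 2 ^ (_ + 1 + 1)
    rw [Nat.div_div_eq_div_mul, pow_succ 2 (_ + 1), add_right_comm n 1, ← add_assoc n]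
  have hDev : ∀ n m a, J (n + m + 1) = 2 * (a + 1) → D n m = a / 2 ^ m := fun n m a h => by
    change (J (n + m + 1) - 1) / 2 ^ (m + 1) = _
    rw [h, pow_succ', ← Nat.div_div_eq_div_mul]
    congr 1
    omega
  refine ⟨B, ⟨?_, hhalf, ?_⟩, fun n => ?_⟩
  · have h1 := hBle 0 0
    change _ ≤ (J 1 - 1) / 2 ^ 1 at h1
    omega
  · -- Otherwise all late digits are ones, so that the limit is a dyadic rational. The position
    -- attains it from some level on, and cannot drop strictly any more.
    by_contra hodd
    rw [not_frequently, eventually_atTop] at hodd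
    obtain ⟨n, hn⟩ := hodd
    have hpow : ∀ m, B (n + m) + 1 = 2 ^ m * (B n + 1) := fun m => by
      induction m with
      | zero => simp
      | succ m ih =>
        have h1 := hhalf (n + m)
        have h2 := Nat.not_even_iff_odd.1 (hn (n + (m + 1)) (by omega))
        rw [pow_succ', mul_assoc, ← ih]
        rw [← add_assoc] at h2 ⊢
        obtain ⟨t, ht⟩ := h2
        omega
    obtain ⟨k, hk, a, -, h1, h2⟩ := frequently_atTop.1 hev (n + N n + 1)
    obtain ⟨m, rfl⟩ := Nat.exists_eq_add_of_le hk
    have h3 : D n (N n + m) = B n := hB n _ (by omega)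
    have h4 : J (n + (N n + m) + 1) - 1 < 2 ^ (N n + m + 1) * (B n + 1) := by
      rw [← h3]
      exact Nat.lt_mul_div_succ _ (by positivity)
    rw [← hpow] at h4
    have h5 : B (n + N n + 1 + m) ≤ a := (hBle _ 0).trans (hDev _ 0 a h2 ▸ by simp)
    rw [show n + (N n + m) + 1 = n + N n + 1 + m by ring,
      show n + (N n + m + 1) = n + N n + 1 + m by ring] at h4
    omega
  · obtain ⟨k, hk, a, h0, -, h2⟩ := frequently_atTop.1 hev (n + N n)
    obtain ⟨m, rfl⟩ := Nat.exists_eq_add_of_le hk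
    rw [add_assoc] at h0
    rw [← hB n (N n + m) (by omega), hDev n _ a (by rw [← h2, ← add_assoc])]
    simpa using hR _ n a (by omega) h0

/-- One move of a counter game: subtract the first component, which must not exceed the counter,
then add the second one. The third component tells whether the move is an accepting one. -/
abbrev Move := ℕ × ℕ × Bool

/-- The sequence `o` of moves, chosen from the lists `g k`, is legal when started with an empty
counter, and accepting moves are infinitely frequent; `c` is the sequence of counter values. -/
structure IsWinningPlay (g : ℕ → List Move) (o : ℕ → Move) (c : ℕ → ℕ) : Prop where
  zero : c 0 = 0
  mem : ∀ k, o k ∈ g k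
  le : ∀ k, (o k).1 ≤ c k
  succ : ∀ k, c (k + 1) = c k - (o k).1 + (o k).2.1
  accepting : ∃ᶠ k in atTop, (o k).2.2 = true

open Classical in
/-- The moves offered at level `k` when `T` is the set of nodes of the tree on that level.
The counter value `scale k * j` stands for the position `j / 2 ^ k`. At level `0`
the position is set to `1`; later it may be kept (up to rounding down), or else lowered,
with acceptance, from `(a + 2) / 2 ^ k` or above to `(a + 1) / 2 ^ k`, where `a` is a node. -/
noncomputable def moves (T : ℕ → Prop) : ℕ → List Move
  | 0 => [(0, scale 1 * 2, false)]
  | k + 1 =>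
    (List.range (2 ^ (k + 1) + 1)).map
        (fun j => (scale (k + 1) * j, scale (k + 2) * (2 * j), false)) ++
      ((List.range (2 ^ (k + 1))).filter (fun a => T a)).map
        (fun a => (scale (k + 1) * (a + 2), scale (k + 2) * (2 * (a + 1)), true))

theorem mem_moves_succ {T : ℕ → Prop} {k : ℕ} {o : Move} :
    o ∈ moves T (k + 1) ↔
      (∃ j ≤ 2 ^ (k + 1), o = (scale (k + 1) * j, scale (k + 2) * (2 * j), false)) ∨
      ∃ a < 2 ^ (k + 1), T a ∧
        o = (scale (k + 1) * (a + 2), scale (k + 2) * (2 * (a + 1)), true) := by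
  simp only [moves, List.mem_append, List.mem_map, List.mem_range, List.mem_filter,
    decide_eq_true_eq, Nat.lt_succ_iff, and_assoc, eq_comm (b := o)]

theorem exists_isWinningPlay_of_isBranch {R : ℕ → ℕ → Prop} {B : ℕ → ℕ} (hB : IsBranch B)
    (hR : ∀ k, R k (B k)) : ∃ o c, IsWinningPlay (fun k => moves (R k) k) o c := by
  classical
  -- The position after level `k` is the right endpoint of the interval given by `B k`.
  let o : ℕ → Move := fun k => (if k = 0 then 0 else
    if Even (B k) then scale k * (B k + 2) else scale k * (B k + 1),
      scale (k + 1) * (2 * (B k + 1)), decide (k ≠ 0 ∧ Even (B k)))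
  let c : ℕ → ℕ := fun k => if k = 0 then 0 else scale k * (2 * (B (k - 1) + 1))
  have hoc : ∀ k, (o k).1 = c k := fun k => by
    cases k with
    | zero => rfl
    | succ k =>
      have h := hB.half k
      simp only [o, c, Nat.succ_ne_zero, if_false, Nat.add_sub_cancel]
      split_ifs with he
      · obtain ⟨t, ht⟩ := he
        congr 1; omega
      · obtain ⟨t, ht⟩ := Nat.not_even_iff_odd.1 he
        congr 1; omega
  refine ⟨o, c, rfl, fun k => ?_, fun k => (hoc k).le, fun k => ?_, ?_⟩
  · cases k with
    | zero => simp [o, moves, hB.zero]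
    | succ k =>
      refine mem_moves_succ.2 ?_
      have hlt := hB.lt_two_pow (k + 1)
      by_cases he : Even (B (k + 1))
      · exact Or.inr ⟨B (k + 1), hlt, hR _, by simp [o, he]⟩
      · exact Or.inl ⟨B (k + 1) + 1, hlt, by simp [o, he]⟩
  · simp only [hoc, Nat.sub_self, zero_add]
    simp [c, o]
  · refine (hB.even.and_eventually (eventually_ge_atTop 1)).mono fun k hk => ?_
    simpa [o] using ⟨by omega, hk.1⟩

theorem exists_isBranch_of_isWinningPlay {R : ℕ → ℕ → Prop}
    (hR : ∀ k n a, n ≤ k → R k a → R n (a / 2 ^ (k - n))) {o : ℕ → Move} {c : ℕ → ℕ}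
    (h : IsWinningPlay (fun k => moves (R k) k) o c) : ∃ B, IsBranch B ∧ ∀ k, R k (B k) := by
  have hc1 : c 1 = scale 1 * 2 := by
    have h0 := h.mem 0
    simp only [moves, List.mem_singleton] at h0
    rw [h.succ 0, h0, h.zero]
    simp
  -- Since the rest of the counter is smaller than the next scaling factor, a move determines
  -- the position exactly.
  have hpos : ∀ k j, c (k + 1) < scale (k + 2) → (o (k + 1)).2.1 = scale (k + 2) * (2 * j) →
      c (k + 2) / scale (k + 2) = 2 * j := fun k j h1 h2 => by
    rw [h.succ (k + 1), h2, Nat.add_mul_div_left _ _ (scale_pos _), Nat.div_eq_of_lt (by omega),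
      zero_add]
  have hgain : ∀ k, ∃ j ≤ 2 ^ (k + 1), (o (k + 1)).2.1 = scale (k + 2) * (2 * j) := fun k => by
    rcases mem_moves_succ.1 (h.mem (k + 1)) with ⟨j, hj, e⟩ | ⟨a, ha, -, e⟩
    · exact ⟨j, hj, by rw [e]⟩
    · exact ⟨a + 1, ha, by rw [e]⟩
  have hlt : ∀ k, c (k + 1) < scale (k + 2) := fun k => by
    induction k with
    | zero =>
      rw [zero_add, hc1]
      have := scale_pos 1
      simp only [scale] at this ⊢
      omega
    | succ k ih =>
      obtain ⟨j, hj, e⟩ := hgain k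
      have h1 := hpos k j ih e
      change c (k + 2) < scale (k + 2) * (2 ^ (k + 2) + 1)
      rw [mul_comm, ← Nat.div_lt_iff_lt_mul (scale_pos _), h1, pow_succ]
      omega
  have hle : ∀ k i, (o k).1 = scale k * i → i ≤ c k / scale k := fun k i e => by
    rw [Nat.le_div_iff_mul_le (scale_pos _), mul_comm, ← e]
    exact h.le k
  refine exists_isBranch_of_positions hR (J := fun k => c k / scale k) ?_ ?_ ?_
  · rw [hc1, Nat.mul_div_cancel_left _ (scale_pos 1)]
  · intro k hk
    obtain ⟨k, rfl⟩ := Nat.exists_eq_add_of_le' hk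
    rcases mem_moves_succ.1 (h.mem (k + 1)) with ⟨j, hj, e⟩ | ⟨a, ha, -, e⟩
    · have := hle (k + 1) j (by rw [e])
      rw [hpos k j (hlt k) (by rw [e])]
      omega
    · have := hle (k + 1) (a + 2) (by rw [e])
      rw [hpos k (a + 1) (hlt k) (by rw [e])]
      omega
  · refine (h.accepting.and_eventually (eventually_ge_atTop 1)).mono ?_
    rintro k ⟨hk, hk1⟩
    obtain ⟨k, rfl⟩ := Nat.exists_eq_add_of_le' hk1
    rcases mem_moves_succ.1 (h.mem (k + 1)) with ⟨j, hj, e⟩ | ⟨a, ha, hT, e⟩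
    · rw [e] at hk
      simp at hk
    · exact ⟨a, hT, hle (k + 1) (a + 2) (by rw [e]), hpos k (a + 1) (hlt k) (by rw [e])⟩

/-! ### Infinite concatenations -/

section Concat

variable {α : Type*}

/-- The length of the concatenation of the first `k` words of a sequence. -/
def offset (b : ℕ → List α) : ℕ → ℕ
  | 0 => 0
  | k + 1 => offset b k + (b k).length

/-- The infinite concatenation of a sequence of nonempty words. The default letter `d` is never
used when all words are nonempty. -/
def concat (d : α) (b : ℕ → List α) (n : ℕ) : α :=
  ((List.range (n + 1)).flatMap b).getD n d

theorem length_flatMap_range (b : ℕ → List α) (k : ℕ) :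
    ((List.range k).flatMap b).length = offset b k := by
  induction k with
  | zero => rfl
  | succ k ih => rw [List.range_succ, List.flatMap_append, List.length_append, ih]; simp [offset]

theorem flatMap_range_prefix (b : ℕ → List α) {k l : ℕ} (h : k ≤ l) :
    (List.range k).flatMap b <+: (List.range l).flatMap b := by
  obtain ⟨m, rfl⟩ := Nat.exists_eq_add_of_le h
  rw [List.range_add, List.flatMap_append]
  exact List.prefix_append _ _

variable {b : ℕ → List α}

theorem offset_strictMono (hb : ∀ k, b k ≠ []) : StrictMono (offset b) :=
  strictMono_nat_of_lt_succ fun k => by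
    have := List.length_pos_of_ne_nil (hb k)
    simp only [offset]
    omega

theorem concat_offset_add (d : α) (hb : ∀ k, b k ≠ []) {k j : ℕ} (hj : j < (b k).length) :
    concat d b (offset b k + j) = (b k)[j] := by
  have hk : offset b k + j < ((List.range (k + 1)).flatMap b).length := by
    rw [length_flatMap_range]
    exact Nat.add_lt_add_left hj _
  have hle : k ≤ offset b k := (offset_strictMono hb).le_apply
  have h1 := (flatMap_range_prefix b
    (show k + 1 ≤ offset b k + j + 1 by omega)).getElem hk
  rw [concat, List.getD_eq_getElem _ _
    (hk.trans_le (flatMap_range_prefix b (by omega)).length_le), ← h1]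
  simp only [List.range_succ, List.flatMap_append, List.flatMap_singleton]
  rw [List.getElem_append_right (by rw [length_flatMap_range]; omega)]
  simp only [length_flatMap_range, Nat.add_sub_cancel_left]

theorem exists_eq_offset_add (hb : ∀ k, b k ≠ []) (n : ℕ) :
    ∃ k j, j < (b k).length ∧ n = offset b k + j := by
  induction n with
  | zero => exact ⟨0, 0, List.length_pos_of_ne_nil (hb 0), rfl⟩
  | succ n ih =>
    obtain ⟨k, j, hj, rfl⟩ := ih
    by_cases h : j + 1 < (b k).length
    · exact ⟨k, j + 1, h, rfl⟩
    · exact ⟨k + 1, 0, List.length_pos_of_ne_nil (hb _), by simp only [offset]; omega⟩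

theorem offset_congr {β : Type*} {b : ℕ → List α} {b' : ℕ → List β}
    (h : ∀ k, (b k).length = (b' k).length) (k : ℕ) : offset b k = offset b' k := by
  induction k with
  | zero => rfl
  | succ k ih => simp [offset, ih, h]

/-- A property is satisfied infinitely often along a concatenation iff it is satisfied within
infinitely many of its words. -/
theorem frequently_iff_frequently_block (hb : ∀ k, b k ≠ []) (p : ℕ → Prop) :
    (∃ᶠ n in atTop, p n) ↔ ∃ᶠ k in atTop, ∃ j < (b k).length, p (offset b k + j) := by
  have hmono := offset_strictMono hb
  simp only [frequently_atTop]
  constructor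
  · intro h K
    obtain ⟨n, hn, hp⟩ := h (offset b K)
    obtain ⟨k, j, hj, rfl⟩ := exists_eq_offset_add hb n
    refine ⟨k, ?_, j, hj, hp⟩
    by_contra hk
    have h1 : offset b (k + 1) ≤ offset b K := hmono.monotone (by omega)
    simp only [offset] at h1
    omega
  · intro h a
    obtain ⟨k, hk, j, -, hp⟩ := h a
    exact ⟨_, (hk.trans hmono.le_apply).trans (Nat.le_add_right _ _), hp⟩

end Concat

/-! ### Runs of the automaton on words made of blocks -/

/-- The state and the counter value. -/
abbrev Conf := Ctrl × ℕ

/-- The transition relation between configurations. -/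
def Trans (a : Letter) (x y : Conf) : Prop :=
  ∃ j : SignType, Edge x.1 a j y.1 ∧ (y.2 : ℤ) = x.2 + (j : ℤ)

theorem step_iff_trans {a : Letter} {x y : Ctrl × (Fin 1 → ℕ)} :
    A₁.Step a x y ↔ Trans a (x.1, x.2 0) (y.1, y.2 0) := by
  constructor
  · rintro ⟨i, j, ⟨h, -⟩, -, h2⟩
    exact ⟨j 0, h, h2 0⟩
  · rintro ⟨j, h1, h2⟩
    refine ⟨fun _ => decide (x.2 0 ≠ 0), fun _ => j, ⟨h1, fun h3 hj => ?_⟩, fun m => ?_,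
      fun m => ?_⟩
    · have : x.2 0 = 0 := by simpa using h3
      simp only at hj h2
      rw [this, hj] at h2
      simp at h2
    · rw [Subsingleton.elim m 0]; simp
    · rw [Subsingleton.elim m 0]; exact h2

theorem trans_q0 {a : Letter} {c : ℕ} {y : Conf} :
    Trans a (.q0, c) y ↔ (a ≠ .sharp ∧ y = (.q0, c)) ∨ (a = .lt ∧ y = (.q1, c)) := by
  constructor
  · rintro ⟨j, h, h2⟩
    obtain ⟨q, e⟩ := y
    cases h <;> simp_all
  · rintro (⟨h, rfl⟩ | ⟨rfl, rfl⟩)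
    · exact ⟨0, .skip0 a h, by simp⟩
    · exact ⟨0, .choose, by simp⟩

theorem trans_q1 {a : Letter} {c : ℕ} {y : Conf} :
    Trans a (.q1, c) y ↔ (a = .d ∧ 1 ≤ c ∧ y = (.q1, c - 1)) ∨ (a = .bar ∧ y = (.q2, c)) := by
  constructor
  · rintro ⟨j, h, h2⟩
    obtain ⟨q, e⟩ := y
    cases h <;> simp_all
    omega
  · rintro (⟨rfl, h, rfl⟩ | ⟨rfl, rfl⟩)
    · exact ⟨-1, .dec, by simp; omega⟩
    · exact ⟨0, .bar, by simp⟩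

theorem trans_q2 {a : Letter} {c : ℕ} {y : Conf} :
    Trans a (.q2, c) y ↔ (a = .i ∧ y = (.q2, c + 1)) ∨ (a = .plus ∧ y = (.qa, c)) ∨
      (a = .minus ∧ y = (.qr, c)) := by
  constructor
  · rintro ⟨j, h, h2⟩
    obtain ⟨q, e⟩ := y
    cases h <;> simp_all
    omega
  · rintro (⟨rfl, rfl⟩ | ⟨rfl, rfl⟩ | ⟨rfl, rfl⟩)
    · exact ⟨1, .inc, by simp⟩
    · exact ⟨0, .accept, by simp⟩
    · exact ⟨0, .reject, by simp⟩

theorem trans_qa {a : Letter} {c : ℕ} {y : Conf} :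
    Trans a (.qa, c) y ↔ a = .gt ∧ y = (.q3, c) := by
  constructor
  · rintro ⟨j, h, h2⟩
    obtain ⟨q, e⟩ := y
    cases h; simp_all
  · rintro ⟨rfl, rfl⟩
    exact ⟨0, .closeAccept, by simp⟩

theorem trans_qr {a : Letter} {c : ℕ} {y : Conf} :
    Trans a (.qr, c) y ↔ a = .gt ∧ y = (.q3, c) := by
  constructor
  · rintro ⟨j, h, h2⟩
    obtain ⟨q, e⟩ := y
    cases h; simp_all
  · rintro ⟨rfl, rfl⟩
    exact ⟨0, .closeReject, by simp⟩

theorem trans_q3 {a : Letter} {c : ℕ} {y : Conf} :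
    Trans a (.q3, c) y ↔ (a ≠ .sharp ∧ y = (.q3, c)) ∨ (a = .sharp ∧ y = (.q0, c)) := by
  constructor
  · rintro ⟨j, h, h2⟩
    obtain ⟨q, e⟩ := y
    cases h <;> simp_all
  · rintro (⟨h, rfl⟩ | ⟨rfl, rfl⟩)
    · exact ⟨0, .skip3 a h, by simp⟩
    · exact ⟨0, .next, by simp⟩

/-- `Reach w x b y`: some run reads the word `w` from `x` to `y`, and `b` says whether it visits
the accepting state before its last configuration. -/
def Reach : List Letter → Conf → Prop → Conf → Prop
  | [], x, b, y => ¬ b ∧ y = x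
  | a :: w, x, b, y => ∃ x' b', Trans a x x' ∧ Reach w x' b' y ∧ (b ↔ x.1 = .qa ∨ b')

theorem reach_iff_exists {w : List Letter} {x y : Conf} {b : Prop} :
    Reach w x b y ↔ ∃ ρ : ℕ → Conf, ρ 0 = x ∧ ρ w.length = y ∧
      (∀ j (hj : j < w.length), Trans w[j] (ρ j) (ρ (j + 1))) ∧
      (b ↔ ∃ j < w.length, (ρ j).1 = .qa) := by
  induction w generalizing x b with
  | nil =>
    simp only [Reach]
    constructor
    · rintro ⟨hb, rfl⟩
      exact ⟨fun _ => y, rfl, rfl, by simp, by simpa using hb⟩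
    · rintro ⟨ρ, rfl, rfl, -, hb⟩
      exact ⟨by simpa using hb, rfl⟩
  | cons a w ih =>
    simp only [Reach, ih]
    constructor
    · rintro ⟨x', b', ht, ⟨ρ, rfl, rfl, h1, h2⟩, hb⟩
      refine ⟨fun n => Nat.casesOn n x ρ, rfl, rfl, ?_, ?_⟩
      · rintro (_ | j) hj
        · exact ht
        · exact h1 j (by simpa using hj)
      · rw [hb, h2]
        constructor
        · rintro (h | ⟨j, hj, h⟩)
          · exact ⟨0, by simp, h⟩
          · exact ⟨j + 1, by simpa using hj, h⟩
        · rintro ⟨_ | j, hj, h⟩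
          · exact Or.inl h
          · exact Or.inr ⟨j, by simpa using hj, h⟩
    · rintro ⟨ρ, rfl, rfl, h1, h2⟩
      refine ⟨ρ 1, ∃ j < w.length, (ρ (j + 1)).1 = .qa, h1 0 (by simp),
        ⟨fun n => ρ (n + 1), rfl, rfl, fun j hj => h1 (j + 1) (by simpa using hj), Iff.rfl⟩, ?_⟩
      rw [h2]
      constructor
      · rintro ⟨_ | j, hj, h⟩
        · exact Or.inl h
        · exact Or.inr ⟨j, by simpa using hj, h⟩
      · rintro (h | ⟨j, hj, h⟩)
        · exact ⟨0, by simp, h⟩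
        · exact ⟨j + 1, by simpa using hj, h⟩

theorem reach_cons_of_ne {a : Letter} {w : List Letter} {x y : Conf} {b : Prop}
    (hx : x.1 ≠ .qa) : Reach (a :: w) x b y ↔ ∃ x', Trans a x x' ∧ Reach w x' b y := by
  simp only [Reach, hx, false_or]
  constructor
  · rintro ⟨x', b', h1, h2, h3⟩
    exact ⟨x', h1, by rwa [h3]⟩
  · rintro ⟨x', h1, h2⟩
    exact ⟨x', b, h1, h2, Iff.rfl⟩

theorem reach_q1 {n c : ℕ} {v : List Letter} {b : Prop} {y : Conf} :
    Reach (List.replicate n .d ++ .bar :: v) (.q1, c) b y ↔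
      n ≤ c ∧ Reach v (.q2, c - n) b y := by
  induction n generalizing c with
  | zero => simp [reach_cons_of_ne, trans_q1]
  | succ n ih =>
    rw [List.replicate_succ, List.cons_append, reach_cons_of_ne (by simp)]
    simp only [trans_q1, true_and, reduceCtorEq, false_and, or_false, and_assoc,
      exists_and_left, exists_eq_left, ih, Nat.sub_sub, Nat.add_comm 1 n]
    rw [← and_assoc]
    exact and_congr_left fun _ => by omega

theorem reach_q2 {m c : ℕ} {v : List Letter} {b : Prop} {y : Conf} :
    Reach (List.replicate m .i ++ v) (.q2, c) b y ↔ Reach v (.q2, c + m) b y := by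
  induction m generalizing c with
  | zero => simp
  | succ m ih =>
    rw [List.replicate_succ, List.cons_append, reach_cons_of_ne (by simp)]
    simp [trans_q2, ih, add_assoc, add_comm 1 m]

theorem reach_q3 {u : List Letter} (hu : .sharp ∉ u) {c : ℕ} {b : Prop} {y : Conf} :
    Reach (u ++ [.sharp]) (.q3, c) b y ↔ ¬ b ∧ y = (.q0, c) := by
  induction u with
  | nil => simp [reach_cons_of_ne, trans_q3, Reach]
  | cons a u ih =>
    rw [List.mem_cons, not_or] at hu
    rw [List.cons_append, reach_cons_of_ne (by simp)]
    simp [trans_q3, Ne.symm hu.1, ih hu.2]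

/-- A word without `<` and `♯` keeps the automaton in its initial state. -/
theorem reach_q0_append {u v : List Letter} (hu : ∀ a ∈ u, a ≠ .sharp ∧ a ≠ .lt) {c : ℕ}
    {b : Prop} {y : Conf} : Reach (u ++ v) (.q0, c) b y ↔ Reach v (.q0, c) b y := by
  induction u with
  | nil => simp
  | cons a u ih =>
    rw [List.forall_mem_cons] at hu
    rw [List.cons_append, reach_cons_of_ne (by simp)]
    simp [trans_q0, hu.1.1, hu.1.2, ih hu.2]

/-- The code `dⁿ|iᵐ±>` of a move, without its opening `<`. -/
def moveTail (o : Move) : List Letter :=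
  List.replicate o.1 .d ++ .bar ::
    (List.replicate o.2.1 .i ++ [if o.2.2 then .plus else .minus, .gt])

theorem ne_of_mem_moveTail {o : Move} {a : Letter} (h : a ∈ moveTail o) :
    a ≠ .sharp ∧ a ≠ .lt := by
  simp only [moveTail, List.mem_append, List.mem_replicate, List.mem_cons, List.not_mem_nil,
    or_false] at h
  obtain ⟨-, rfl⟩ | rfl | ⟨-, rfl⟩ | rfl | rfl := h
  all_goals first | decide | (split_ifs <;> decide)

/-- The block that offers a choice between the moves of a list. -/
def block (L : List Move) : List Letter :=
  L.flatMap (fun o => .lt :: moveTail o) ++ [.sharp]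

theorem block_ne_nil (L : List Move) : block L ≠ [] := by simp [block]

theorem sharp_notMem_flatMap (L : List Move) :
    .sharp ∉ L.flatMap (fun o => .lt :: moveTail o) := by
  simp only [List.mem_flatMap, List.mem_cons, reduceCtorEq, false_or, not_exists, not_and]
  exact fun o _ h => (ne_of_mem_moveTail h).1 rfl

theorem reach_moveTail {o : Move} {u : List Letter} (hu : .sharp ∉ u) {c : ℕ} {b : Prop}
    {y : Conf} : Reach (moveTail o ++ (u ++ [.sharp])) (.q1, c) b y ↔
      o.1 ≤ c ∧ y = (.q0, c - o.1 + o.2.1) ∧ (b ↔ o.2.2 = true) := by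
  rw [moveTail, List.append_assoc, List.cons_append, List.append_assoc, reach_q1, reach_q2]
  refine and_congr_right fun _ => ?_
  cases ho : o.2.2
  · simp [reach_cons_of_ne, trans_q2, trans_qr, reach_q3 hu, and_comm]
  · simp only [if_true, List.cons_append, List.nil_append]
    rw [reach_cons_of_ne (by simp)]
    simp only [trans_q2, reduceCtorEq, false_and, true_and, false_or, or_false, exists_eq_left,
      Reach, trans_qa, true_or, iff_true]
    constructor
    · rintro ⟨_, _, rfl, h, hb⟩
      exact ⟨((reach_q3 hu).1 h).2, hb⟩
    · rintro ⟨rfl, hb⟩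
      exact ⟨_, False, rfl, (reach_q3 hu).2 ⟨not_false, rfl⟩, hb⟩

theorem reach_block {L : List Move} {c : ℕ} {b : Prop} {y : Conf} :
    Reach (block L) (.q0, c) b y ↔
      ∃ o ∈ L, o.1 ≤ c ∧ y = (.q0, c - o.1 + o.2.1) ∧ (b ↔ o.2.2 = true) := by
  induction L with
  | nil => simp [block, reach_cons_of_ne, trans_q0]
  | cons o L ih =>
    have hL := sharp_notMem_flatMap L
    rw [block] at ih ⊢
    rw [List.flatMap_cons, List.cons_append, List.cons_append, reach_cons_of_ne (by simp)]
    simp only [trans_q0, ne_eq, reduceCtorEq, not_false_eq_true, true_and, or_and_right, exists_or,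
      exists_eq_left, List.append_assoc, List.mem_cons,
      reach_q0_append (fun a h => ne_of_mem_moveTail (o := o) h), ih, reach_moveTail hL]
    exact or_comm

theorem mem_language_iff {σ : ℕ → Letter} :
    σ ∈ A₁.language ↔ ∃ r : ℕ → Conf, r 0 = (.q0, 0) ∧ (∀ n, Trans (σ n) (r n) (r (n + 1))) ∧
      ∃ᶠ n in atTop, (r n).1 = .qa := by
  constructor
  · rintro ⟨r, ⟨h0, h1⟩, q, hq, rfl⟩
    refine ⟨fun n => ((r n).1, (r n).2 0), by dsimp only; rw [h0]; rfl, fun n => step_iff_trans.1 (h1 n), ?_⟩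
    exact Nat.frequently_atTop_iff_infinite.2 hq
  · rintro ⟨r, h0, h1, h2⟩
    refine ⟨fun n => ((r n).1, fun _ => (r n).2), ⟨by dsimp only; rw [h0]; rfl,
      fun n => step_iff_trans.2 (h1 n)⟩, .qa, ?_, rfl⟩
    exact Nat.frequently_atTop_iff_infinite.1 h2

/-- The automaton accepts a sequence of blocks iff it can win the counter game they encode. -/
theorem concat_mem_language_iff {g : ℕ → List Move} (z : Letter) :
    concat z (fun k => block (g k)) ∈ A₁.language ↔ ∃ o c, IsWinningPlay g o c := by
  have hb : ∀ k, block (g k) ≠ [] := fun k => block_ne_nil _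
  set off := offset (fun k => block (g k)) with hoff
  have hoffs : ∀ k, off (k + 1) = off k + (block (g k)).length := fun k => rfl
  rw [mem_language_iff]
  constructor
  · rintro ⟨r, h0, h1, h2⟩
    have hreach : ∀ k, Reach (block (g k)) (r (off k))
        (∃ j < (block (g k)).length, (r (off k + j)).1 = .qa) (r (off (k + 1))) := fun k => by
      refine reach_iff_exists.2 ⟨fun j => r (off k + j), rfl, rfl, fun j hj => ?_, Iff.rfl⟩
      rw [← concat_offset_add (b := fun k => block (g k)) z hb hj]
      exact h1 _
    have hq : ∀ k, (r (off k)).1 = .q0 := fun k => by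
      induction k with
      | zero => change (r 0).1 = _; rw [h0]
      | succ k ih =>
        have h := hreach k
        rw [← Prod.mk.eta (p := r (off k)), ih, reach_block] at h
        obtain ⟨o, -, -, h, -⟩ := h
        rw [h]
    have hex : ∀ k, ∃ o ∈ g k, o.1 ≤ (r (off k)).2 ∧
        r (off (k + 1)) = (.q0, (r (off k)).2 - o.1 + o.2.1) ∧
        ((∃ j < (block (g k)).length, (r (off k + j)).1 = .qa) ↔ o.2.2 = true) := fun k => by
      rw [← reach_block, ← hq k]
      exact hreach k
    choose o ho hle hs hacc using hex
    refine ⟨o, fun k => (r (off k)).2, ?_, ho, hle, fun k => by rw [hs k], ?_⟩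
    · change (r 0).2 = 0; rw [h0]
    · exact ((frequently_iff_frequently_block hb _).1 h2).mono fun k hk => (hacc k).1 hk
  · rintro ⟨o, c, hc0, ho, hle, hs, hacc⟩
    have hreach : ∀ k, Reach (block (g k)) (.q0, c k) ((o k).2.2 = true) (.q0, c (k + 1)) :=
      fun k => reach_block.2 ⟨o k, ho k, hle k, by rw [hs k], Iff.rfl⟩
    choose ρ hρ0 hρ1 hρt hρa using fun k => reach_iff_exists.1 (hreach k)
    let cs : ℕ → List Conf := fun k => (List.range (block (g k)).length).map (ρ k)
    have hlen : ∀ k, (cs k).length = (block (g k)).length := fun k => by simp [cs]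
    have hcs : ∀ k, cs k ≠ [] := fun k h => hb k (List.length_eq_zero_iff.1 (by simp [← hlen, h]))
    have hoff' : ∀ k, offset cs k = off k := offset_congr hlen
    have hr : ∀ k j, j ≤ (block (g k)).length → concat (.q0, 0) cs (off k + j) = ρ k j := by
      have key : ∀ k j, j < (block (g k)).length → concat (.q0, 0) cs (off k + j) = ρ k j :=
        fun k j hj => by
          rw [← hoff', concat_offset_add _ hcs (by rwa [hlen])]
          simp [cs]
      intro k j hj
      rcases hj.lt_or_eq with hj | rfl
      · exact key k j hj
      · have h := key (k + 1) 0 (List.length_pos_of_ne_nil (hb _))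
        rwa [add_zero, hoffs, hρ0, ← hρ1 k] at h
    refine ⟨concat (.q0, 0) cs, ?_, fun n => ?_, ?_⟩
    · have h := hr 0 0 (Nat.zero_le _)
      rwa [hρ0, hc0] at h
    · obtain ⟨k, j, hj, rfl⟩ := exists_eq_offset_add hb n
      rw [concat_offset_add (b := fun k => block (g k)) z hb hj, ← hoff, add_assoc, hr k j hj.le,
        hr k (j + 1) hj]
      exact hρt k j hj
    · refine (frequently_iff_frequently_block hb _).2 (hacc.mono fun k hk => ?_)
      obtain ⟨j, hj, h⟩ := (hρa k).1 hk
      exact ⟨j, hj, by rw [← hoff, hr k j hj.le]; exact h⟩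

/-! ### The reduction and the topological conclusions -/

theorem continuous_concat_block {Y : Type*} [TopologicalSpace Y] [DiscreteTopology Y]
    (z : Letter) (g : ℕ → List Y → List Move) :
    Continuous fun x : ℕ → Y => concat z fun k => block (g k (pref x k)) := by
  refine continuous_pi fun n => IsLocallyConstant.continuous ?_
  refine (IsLocallyConstant.iff_eventually_eq _).2 fun x => ?_
  filter_upwards [(IsLocallyConstant.iff_eventually_eq _).1 (isLocallyConstant_pref n) x]
    with y hy
  have hk : ∀ k ≤ n, pref y k = pref x k := fun k hk =>
    pref_eq_iff.2 fun i hi => pref_eq_iff.1 hy i (by omega)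
  simp only [concat]
  congr 1
  simp only [List.flatMap_def]
  congr 1
  refine List.map_congr_left fun k hkn => ?_
  rw [hk k (Nat.lt_succ_iff.1 (List.mem_range.1 hkn))]

/-- Every analytic set of infinite words reduces to the language of the automaton: the word
assigned to `x` lists, block by block, the moves of the game on the tree of `x`. -/
theorem exists_continuous_preimage_eq {Y : Type*} [TopologicalSpace Y] [DiscreteTopology Y]
    {E : Set (ℕ → Y)} (hE : AnalyticSet E) :
    ∃ f : (ℕ → Y) → (ℕ → Letter), Continuous f ∧ E = f ⁻¹' A₁.language := by
  obtain ⟨R, hR, hRE⟩ := exists_tree_of_analyticSet hE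
  refine ⟨_, continuous_concat_block .sharp fun k u => moves (R u) k, ?_⟩
  ext x
  rw [hRE, Set.mem_preimage, concat_mem_language_iff]
  constructor
  · rintro ⟨B, hB, h⟩
    exact exists_isWinningPlay_of_isBranch (R := fun k => R (pref x k)) hB h
  · rintro ⟨o, c, h⟩
    exact exists_isBranch_of_isWinningPlay (R := fun k => R (pref x k)) (fun k n a => hR x k n a) h

theorem analyticSet_setOf_exists {X Z : Type*} [TopologicalSpace X] [PolishSpace X]
    [TopologicalSpace Z] [PolishSpace Z] {P : X → Z → Prop}
    (hP : MeasurableSet[borel (X × Z)] {p : X × Z | P p.1 p.2}) :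
    AnalyticSet {x | ∃ z, P x z} := by
  borelize (X × Z)
  convert hP.analyticSet.image_of_continuous continuous_fst using 1
  ext x
  simp

instance polishSpace_words (D : Type*) [TopologicalSpace D] [DiscreteTopology D] [Countable D] :
    PolishSpace (ℕ → D) := by
  have : PolishSpace D := inferInstance
  infer_instance

theorem measurableSet_setOf_frequently {X : Type*} [MeasurableSpace X] {P : ℕ → X → Prop}
    (hP : ∀ n, MeasurableSet {x | P n x}) : MeasurableSet {x | ∃ᶠ n in atTop, P n x} := by
  have : {x | ∃ᶠ n in atTop, P n x} = ⋂ a, ⋃ b, ⋃ _ : b ≥ a, {x | P b x} := by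
    ext x
    simp [frequently_atTop]
  rw [this]
  exact .iInter fun a => .iUnion fun b => .iUnion fun _ => hP b

theorem measurableSet_setOf_comp {X D : Type*} [TopologicalSpace X] [MeasurableSpace X]
    [BorelSpace X] [TopologicalSpace D] [DiscreteTopology D] {f : X → D} (hf : Continuous f)
    (Q : D → Prop) : MeasurableSet {x | Q (f x)} :=
  ((isClopen_discrete {y | Q y}).preimage hf).isOpen.measurableSet

theorem analyticSet_language : AnalyticSet A₁.language := by
  let : TopologicalSpace Ctrl := ⊥
  have : DiscreteTopology Ctrl := ⟨rfl⟩
  have : A₁.language = {σ | ∃ r : ℕ → Conf, r 0 = (.q0, 0) ∧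
      (∀ n, Trans (σ n) (r n) (r (n + 1))) ∧ ∃ᶠ n in atTop, (r n).1 = .qa} :=
    Set.ext fun σ => mem_language_iff
  rw [this]
  refine analyticSet_setOf_exists ?_
  borelize ((ℕ → Letter) × (ℕ → Conf))
  refine .inter ?_ (.inter ?_ ?_)
  · exact measurableSet_setOf_comp (f := fun p : (ℕ → Letter) × (ℕ → Conf) => p.2 0)
      (by fun_prop) fun y => y = (.q0, 0)
  · change MeasurableSet {p : (ℕ → Letter) × (ℕ → Conf) |
      ∀ n, Trans (p.1 n) (p.2 n) (p.2 (n + 1))}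
    rw [Set.ofPred_forall]
    exact .iInter fun n => measurableSet_setOf_comp
      (f := fun p : (ℕ → Letter) × (ℕ → Conf) => (p.1 n, p.2 n, p.2 (n + 1)))
      (by fun_prop) fun y => Trans y.1 y.2.1 y.2.2
  · exact measurableSet_setOf_frequently fun n => measurableSet_setOf_comp
      (f := fun p : (ℕ → Letter) × (ℕ → Conf) => p.2 n) (by fun_prop) fun y => y.1 = .qa

/-- The infinite words `x` over two letters that, read as the characteristic function of a tree in
the sense of `exists_tree_of_analyticSet`, accept themselves. -/
def selfAccepting : Set (ℕ → Bool) :=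
  {x | ∃ B, IsBranch B ∧ ∀ k, x (Encodable.encode (pref x k, B k)) = true}

theorem analyticSet_selfAccepting : AnalyticSet selfAccepting := by
  refine analyticSet_setOf_exists ?_
  borelize ((ℕ → Bool) × (ℕ → ℕ))
  refine .inter ?_ ?_
  · have : {p : (ℕ → Bool) × (ℕ → ℕ) | IsBranch p.2} =
        {p | p.2 0 = 0} ∩ ({p | ∀ n, p.2 (n + 1) / 2 = p.2 n} ∩
          {p | ∃ᶠ n in atTop, Even (p.2 n)}) :=
      Set.ext fun p => ⟨fun h => ⟨h.1, h.2, h.3⟩, fun h => ⟨h.1, h.2.1, h.2.2⟩⟩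
    change MeasurableSet {p : (ℕ → Bool) × (ℕ → ℕ) | IsBranch p.2}
    rw [this]
    refine .inter ?_ (.inter ?_ ?_)
    · exact measurableSet_setOf_comp (f := fun p : (ℕ → Bool) × (ℕ → ℕ) => p.2 0)
        (by fun_prop) fun y => y = 0
    · rw [Set.ofPred_forall]
      exact .iInter fun n => measurableSet_setOf_comp
        (f := fun p : (ℕ → Bool) × (ℕ → ℕ) => (p.2 n, p.2 (n + 1)))
        (by fun_prop) fun y => y.2 / 2 = y.1
    · exact measurableSet_setOf_frequently fun n => measurableSet_setOf_comp
        (f := fun p : (ℕ → Bool) × (ℕ → ℕ) => p.2 n) (by fun_prop) fun y => Even y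
  · change MeasurableSet {p : (ℕ → Bool) × (ℕ → ℕ) |
      ∀ k, p.1 (Encodable.encode (pref p.1 k, p.2 k)) = true}
    rw [Set.ofPred_forall]
    refine .iInter fun k => ?_
    -- Once the finite data `(pref x k, B k)` are fixed, the condition concerns one letter of `x`.
    have : {p : (ℕ → Bool) × (ℕ → ℕ) | p.1 (Encodable.encode (pref p.1 k, p.2 k)) = true} =
        ⋃ u : List Bool × ℕ, {p | pref p.1 k = u.1} ∩ ({p | p.2 k = u.2} ∩
          {p | p.1 (Encodable.encode u) = true}) := by
      ext p
      simp only [Set.mem_ofPred_eq, Set.mem_iUnion, Set.mem_inter_iff]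
      exact ⟨fun h => ⟨_, rfl, rfl, h⟩, fun ⟨⟨u, a⟩, h1, h2, h3⟩ => by
        dsimp only at h1 h2; rwa [h1, h2]⟩
    rw [this]
    refine .iUnion fun u => .inter ?_ (.inter ?_ ?_)
    · exact ((isLocallyConstant_pref k).isClopen_fiber u.1 |>.preimage
        continuous_fst).isOpen.measurableSet
    · exact measurableSet_setOf_comp (f := fun p : (ℕ → Bool) × (ℕ → ℕ) => p.2 k)
        (by fun_prop) fun y => y = u.2
    · exact measurableSet_setOf_comp
        (f := fun p : (ℕ → Bool) × (ℕ → ℕ) => p.1 (Encodable.encode u))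
        (by fun_prop) fun y => y = true

/-- A diagonal argument: the trees of analytic sets can be coded by infinite binary words, and the
code of a tree for the complement of `selfAccepting` would contradict itself. -/
theorem not_analyticSet_compl_selfAccepting : ¬ AnalyticSet selfAcceptingᶜ := by
  classical
  intro h
  obtain ⟨R, -, hR⟩ := exists_tree_of_analyticSet h
  let y : ℕ → Bool := fun n => decide (∃ u a, Encodable.encode (u, a) = n ∧ R u a)
  have hy : ∀ u a, y (Encodable.encode (u, a)) = true ↔ R u a := fun u a => by
    simp only [y, decide_eq_true_eq]
    constructor
    · rintro ⟨u', a', he, h⟩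
      obtain ⟨rfl, rfl⟩ := Prod.mk.inj (Encodable.encode_injective he)
      exact h
    · exact fun h => ⟨u, a, rfl, h⟩
  have h1 := hR y
  have h2 : y ∈ selfAccepting ↔ ∃ B, IsBranch B ∧ ∀ k, R (pref y k) (B k) := by
    simp only [selfAccepting, Set.mem_ofPred_eq, hy]
  rw [← h2, Set.mem_compl_iff] at h1
  exact not_iff_self h1

theorem isBlind : A₁.IsBlind := by
  rintro q a i q' j m ⟨h, -⟩ -
  refine ⟨h, fun h0 => ?_⟩
  rw [Subsingleton.elim m 0, Function.update_self] at h0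
  exact absurd h0 (by decide)

theorem isSigma11Complete_language : IsSigma11Complete A₁.language := by
  intro Y _ _ _ E
  refine ⟨exists_continuous_preimage_eq, ?_⟩
  rintro ⟨f, hf, rfl⟩
  exact analyticSet_language.preimage hf

theorem not_measurableSet_language :
    ¬ MeasurableSet[borel (ℕ → Letter)] A₁.language := by
  intro h
  obtain ⟨f, hf, he⟩ := exists_continuous_preimage_eq analyticSet_selfAccepting
  borelize (ℕ → Bool)
  have hm : MeasurableSet selfAccepting := by
    rw [he]
    exact hf.borel_measurable h
  exact not_analyticSet_compl_selfAccepting hm.compl.analyticSet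

end BlindCounter

theorem mainTheorem2 :
    BlindCounter.A₁.IsBlind ∧
      BlindCounter.IsSigma11Complete BlindCounter.A₁.language ∧
      ¬ @MeasurableSet (ℕ → BlindCounter.Letter) (borel (ℕ → BlindCounter.Letter))
         BlindCounter.A₁.language :=
  ⟨BlindCounter.isBlind, BlindCounter.isSigma11Complete_language,
    BlindCounter.not_measurableSet_language⟩
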